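/- Let $n$ and $r_1,\dots,r_n$ be positive integers, let $N=[r_1]\times\cdots\times[r_n]$, and let $R$ be the polynomial ring over a field in the variables $x_a$, $a\in N$. For $L\subseteq[n]$ and $a,b\in N$ let $s(L,a,b)\in N$ be the index obtained from $a$ by replacing, for every $i\in L$, its $i$th entry by $b_i$; write $s(i,a,b)=s(\{i\},a,b)$. Put $$f_{L,a,b}=x_ax_b-x_{s(L,a,b)}x_{s(L,b,a)},\qquad f_{i,a,b}=f_{\{i\},a,b}.$$ Let $1\le t\le n$. A set $S\subseteq N$ is *$t$-switchable* if $s(i,a,b)\in S$ for all $i\in[t]$ and all $a,b\in S$ that differ in exactly two components. Elements $a,b\in S$ are *connected in $S$* if there are $a=a_0,a_1,\dots,a_k=b$ in $S$ ($k\ge 0$) such that $a_{j-1}$ and $a_j$ differ in exactly one component for $j=1,\dots,k$. Let $$\tilde I^{\langle t\rangle}_S=\bigl(f_{i,a,b} : i\in[t],\ a,b\in S\text{ connected in }S\bigr)\subseteq R .$$ *Diagonal orders.* Enumerate $[r_{t+1}]\times\cdots\times[r_n]$ (a one-point set if $t=n$) and regard the last $n-t$ entries of each $a\in N$ as a single $(t+1)$st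 component $a_{t+1}$, ordered by this enumeration. Switching the $(t+1)$st component means switching all of the last $n-t$ entries; the resulting product $x_{s(t+1,a,b)}x_{s(t+1,b,a)}$ equals $x_{s([t],a,b)}x_{s([t],b,a)}$. Let $\delta_1,\dots,\delta_{t+1}$ be an enumeration of $[t+1]$. A monomial order $<$ on $R$ is a *$t$-diagonal order* relative to $\delta_1,\dots,\delta_{t+1}$ if for all $a,b\in N$: whenever $i$ is the smallest index with $a_{\delta_i}\ne b_{\delta_i}$, and $j>i$ is such that $a_{\delta_j}>b_{\delta_j}$, then $$x_ax_b>x_{s(\delta_j,a,b)}\,x_{s(\delta_j,b,a)}\quad\text{if and only if}\quad a_{\delta_i}>b_{\delta_i}.$$ **Theorem.** Let $1\le t\le n$ and let $S\subseteq N$ be $t$-switchable. Then for every enumeration of $[r_{t+1}]\times\cdots\times[r_n]$, every enumeration $\delta_1,\dots,\delta_{t+1}$ of $[t+1]$ and every $t$-diagonal monomial order relative to these, the set $$G=\{f_{K,a,b} : K\subseteq[t],\ a,b\in S\text{ connected in }S\}$$ is a Gröbner basis of $\tilde I^{\langle t\rangle}_S$: it is a finite subset of $\tilde I^{\langle t\rangle}_S$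 whose leading terms generate the ideal of all leading terms of $\tilde I^{\langle t\rangle}_S$ (the zero polynomial, with leading term $0$, is allowed in $G$). If $S\neq\emptyset$, this Gröbner basis is not minimal: some proper subset of $G$ is also a Gröbner basis of $\tilde I^{\langle t\rangle}_S$. -/

import Mathlib

namespace Hypermatrix

/-- The index set `N = [r₁] × ⋯ × [rₙ]` of an `r₁ × ⋯ × rₙ` hypermatrix (with entries of each
`[rᵢ]` numbered from `0`). -/
abbrev Index {n : ℕ} (r : Fin n → ℕ) : Type := (i : Fin n) → Fin (r i)

/-- The set `[t]` of the first `t` components, as a subset of the set of all `n` components. -/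
def firstComponents (n t : ℕ) : Finset (Fin n) := Finset.univ.filter (fun i => i.val < t)

/-- The switch function `s(L, a, b)`: replace the `L`-entries of `a` by those of `b`. -/
def switch {n : ℕ} {r : Fin n → ℕ} (L : Finset (Fin n)) (a b : Index r) : Index r :=
  fun i => if i ∈ L then b i else a i

/-- `S` is `t`-switchable: `s(i, a, b) ∈ S` for all `a, b ∈ S` that differ in exactly two
components and all `i ∈ [t]`. -/
def IsSwitchable {n : ℕ} {r : Fin n → ℕ} (t : ℕ) (S : Set (Index r)) : Prop :=
  ∀ a ∈ S, ∀ b ∈ S, hammingDist a b = 2 →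
    ∀ i ∈ firstComponents n t, switch {i} a b ∈ S

/-- `a, b ∈ S` are connected in `S`: there is a (possibly constant) path from `a` to `b` inside `S`
whose consecutive members differ in exactly one component. -/
def ConnectedIn {n : ℕ} {r : Fin n → ℕ} (S : Set (Index r)) (a b : Index r) : Prop :=
  a ∈ S ∧ b ∈ S ∧
    Relation.ReflTransGen (fun u v => u ∈ S ∧ v ∈ S ∧ hammingDist u v = 1) a b

/-- The binomial `f_{L,a,b} = x_a x_b - x_{s(L,a,b)} x_{s(L,b,a)}`. -/
noncomputable def minor (k : Type*) [Field k] {n : ℕ} {r : Fin n → ℕ} (L : Finset (Fin n))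
    (a b : Index r) : MvPolynomial (Index r) k :=
  MvPolynomial.X a * MvPolynomial.X b -
    MvPolynomial.X (switch L a b) * MvPolynomial.X (switch L b a)

/-- The ideal `Ĩ_S^{⟨t⟩}` generated by the `f_{i,a,b}` with `i ∈ [t]` and `a, b` connected
in `S`. -/
noncomputable def switchIdeal (k : Type*) [Field k] {n : ℕ} {r : Fin n → ℕ} (t : ℕ)
    (S : Set (Index r)) : Ideal (MvPolynomial (Index r) k) :=
  Ideal.span {p | ∃ i ∈ firstComponents n t, ∃ a b : Index r,
    ConnectedIn S a b ∧ p = minor k {i} a b}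

/-- The set of all `f_{K,a,b}` with `K ⊆ [t]` and `a, b` connected in `S`. -/
def switchBasis (k : Type*) [Field k] {n : ℕ} {r : Fin n → ℕ} (t : ℕ)
    (S : Set (Index r)) : Set (MvPolynomial (Index r) k) :=
  {p | ∃ K ⊆ firstComponents n t, ∃ a b : Index r, ConnectedIn S a b ∧ p = minor k K a b}

/-- The set `[r_{t+1}] × ⋯ × [rₙ]` of possible last `n - t` entries (one point if `t = n`). -/
abbrev Tail {n : ℕ} (r : Fin n → ℕ) (t : ℕ) : Type :=
  (i : {i : Fin n // t ≤ i.val}) → Fin (r i.val)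

/-- The last `n - t` components of an index are merged into a single one by means of an
enumeration `e` of `[r_{t+1}] × ⋯ × [rₙ]`.  This is the `c`-th of the resulting `t + 1` components
(`c = 0, …, t`, the merged one being the component `t`). -/
def component {n : ℕ} {r : Fin n → ℕ} {t : ℕ} (ht : t ≤ n)
    (e : Tail r t ≃ Fin (Fintype.card (Tail r t))) (a : Index r) (c : Fin (t + 1)) : ℕ :=
  if h : c.val < t then (a ⟨c.val, h.trans_le ht⟩).val else (e (fun i => a i.val)).val

/-- The set of original components that is switched in order to switch the `c`-th of the `t + 1`
components: `{c}` if `c < t`, and `[t]` for the merged component `c = t`.  (Switching `[t]` or its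
complement, the set of the merged components, gives the same unordered pair
`{s(L, a, b), s(L, b, a)}`, with the two members exchanged.) -/
def switchSet (n : ℕ) {t : ℕ} (c : Fin (t + 1)) : Finset (Fin n) :=
  if c.val < t then Finset.univ.filter (fun i => i.val = c.val) else firstComponents n t

/-- The exponent vector of the monomial `x_a x_b`. -/
noncomputable def pairExponent {n : ℕ} {r : Fin n → ℕ} (a b : Index r) : Index r →₀ ℕ :=
  Finsupp.single a 1 + Finsupp.single b 1

/-- `m` is a `t`-diagonal monomial order relative to the enumeration `δ` of the `t + 1` components
(and the enumeration `e` of the merged one): whenever `i` is the smallest index such that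
`a_{δ_i} ≠ b_{δ_i}`, and `j > i` is such that `a_{δ_j} > b_{δ_j}`, then
`x_a x_b > x_{s(δ_j,a,b)} x_{s(δ_j,b,a)}` if and only if `a_{δ_i} > b_{δ_i}`. -/
def IsDiagonalOrder {n : ℕ} {r : Fin n → ℕ} {t : ℕ} (ht : t ≤ n)
    (e : Tail r t ≃ Fin (Fintype.card (Tail r t))) (δ : Equiv.Perm (Fin (t + 1)))
    (m : MonomialOrder (Index r)) : Prop :=
  ∀ (a b : Index r) (i j : Fin (t + 1)),
    (∀ l < i, component ht e a (δ l) = component ht e b (δ l)) →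
    component ht e a (δ i) ≠ component ht e b (δ i) →
    i < j →
    component ht e b (δ j) < component ht e a (δ j) →
    (m.toSyn (pairExponent (switch (switchSet n (δ j)) a b) (switch (switchSet n (δ j)) b a)) <
        m.toSyn (pairExponent a b) ↔
      component ht e b (δ i) < component ht e a (δ i))

/-- `G` is a Gröbner basis of the ideal `I` with respect to the monomial order `m`: a finite subset
of `I` whose leading terms generate the ideal of all leading terms of `I`.
(The zero polynomial, with leading term `0`, may belong to `G`.) -/
def IsGroebnerBasis {σ : Type*} {k : Type*} [Field k] (m : MonomialOrder σ)
    (G : Set (MvPolynomial σ k)) (I : Ideal (MvPolynomial σ k)) : Prop :=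
  G.Finite ∧ G ⊆ (I : Set (MvPolynomial σ k)) ∧
    Ideal.span (m.leadingTerm '' G) =
      Ideal.span (m.leadingTerm '' (I : Set (MvPolynomial σ k)))

end Hypermatrix

/-!
The generators of the ideal, and more generally all `f_{K,a,b}` with `K ⊆ [t]`, are differences of
two monomials with the same *marginals*. Here a switchable set `S` falls apart into connected
classes, which are closed under switching components in `[t]` (`ConnectedIn.switch`), and the
marginals of a monomial record, for every class and each of the `t + 1` components, the multiset of
values of that component at the indices of this class occurring in the monomial
(`marginals_switch`). So a polynomial in the ideal never has a monomial which is the only one in the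
support with its marginals (`MvPolynomial.exists_ne_mem_support_of_mem_span`).

Call a monomial standard if it is not divisible by the leading monomial of any nonzero `f_{K,a,b}`.
The diagonal order forces the indices of one class which occur in a standard monomial to be pairwise
antidiagonal: if `a` exceeds `b` in the first component (in the order `δ`) where they differ, then
`a` is at most `b` in all later components. Such a multiset is determined by its marginals
(`Multiset.PairwiseAntidiagonal.eq_of_map_eq`): the elements with the largest first component carry
the smallest values of every other component, so the marginals of this part are determined, and the
argument can be repeated with the next component. Hence there is at most one standard monomial with
given marginals. As the smallest monomial with given marginals is standard, a standard monomial is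
the smallest with its marginals. The leading monomial of a nonzero element of the ideal is not,
since another monomial of the element has the same marginals; so it is not standard, that is, it is
divisible by the leading monomial of some `f_{K,a,b}`.

The Gröbner basis is not minimal because it contains `f_{∅,a,a} = 0` for every `a ∈ S`.
-/

/-! ### Multisets determined by their marginals -/

/-- If a multiset of numbers is split into a lower and an upper part, then the lower part is
determined by its cardinality. -/
theorem Multiset.eq_of_add_eq_add_of_le {A B A' B' : Multiset ℕ} (h : A + B = A' + B')
    (hcard : A.card = A'.card) (hAB : ∀ x ∈ A, ∀ y ∈ B, x ≤ y)
    (hAB' : ∀ x ∈ A', ∀ y ∈ B', x ≤ y) : A = A' := by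
  have key : ∀ C D : Multiset ℕ, (∀ x ∈ C, ∀ y ∈ D, x ≤ y) →
      (C + D).sort = C.sort ++ D.sort := by
    intro C D hCD
    refine List.Perm.eq_of_pairwise' (r := (· ≤ ·)) (pairwise_sort _ _) ?_ ?_
    · refine List.pairwise_append.2 ⟨pairwise_sort _ _, pairwise_sort _ _, fun x hx y hy => ?_⟩
      exact hCD x ((mem_sort _).1 hx) y ((mem_sort _).1 hy)
    · rw [← coe_eq_coe, ← coe_add, sort_eq, sort_eq, sort_eq]
  have h2 : A.sort ++ B.sort = A'.sort ++ B'.sort := by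
    rw [← key A B hAB, ← key A' B' hAB', h]
  have h3 := (List.append_inj h2 (by simpa using hcard)).1
  rw [← sort_eq A (· ≤ ·), ← sort_eq A' (· ≤ ·), h3]

/-- The elements of `U`, whose coordinates are the values of `c 0, …, c (p - 1)`, are pairwise
antidiagonal: if `a` exceeds `b` in the first coordinate in which they differ, then `a` does not
exceed `b` in any later coordinate. -/
def Multiset.PairwiseAntidiagonal {α : Type*} {p : ℕ} (c : Fin p → α → ℕ)
    (U : Multiset α) : Prop :=
  ∀ a ∈ U, ∀ b ∈ U, ∀ i, (∀ l < i, c l a = c l b) → c i b < c i a → ∀ j > i, c j a ≤ c j b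

theorem Multiset.PairwiseAntidiagonal.mono {α : Type*} {p : ℕ} {c : Fin p → α → ℕ}
    {U V : Multiset α} (hU : U.PairwiseAntidiagonal c) (h : V ≤ U) : V.PairwiseAntidiagonal c :=
  fun a ha b hb => hU a (mem_of_le h ha) b (mem_of_le h hb)

/-- In an antidiagonal multiset, the elements with maximal `i`th coordinate (all earlier ones being
constant) have the smallest later coordinates.  Hence two antidiagonal multisets with the same
marginals still have the same marginals after restriction to these elements, and the restriction
can be iterated until all of the first `l` coordinates are constant. -/
theorem Multiset.exists_le_map_eq_of_pairwiseAntidiagonal {α : Type*} {p : ℕ} {c : Fin p → α → ℕ}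
    {U W : Multiset α} (hU : U.PairwiseAntidiagonal c) (hW : W.PairwiseAntidiagonal c)
    (h : ∀ j, U.map (c j) = W.map (c j)) (hU0 : U ≠ 0) (l : ℕ) (hl : l ≤ p) :
    ∃ U' ≤ U, ∃ W' ≤ W, U' ≠ 0 ∧ (∀ j, U'.map (c j) = W'.map (c j)) ∧
      ∀ j : Fin p, j.val < l → ∃ v, (∀ a ∈ U', c j a = v) ∧ ∀ a ∈ W', c j a = v := by
  induction l with
  | zero => exact ⟨U, le_rfl, W, le_rfl, hU0, h, fun j hj => absurd hj (Nat.not_lt_zero _)⟩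
  | succ l ih =>
    obtain ⟨U', hUU, W', hWW, hne, hmap, hconst⟩ := ih (by omega)
    let i : Fin p := ⟨l, by omega⟩
    obtain ⟨a₀, ha₀, hmax⟩ : ∃ a₀ ∈ U', ∀ b ∈ U', c i b ≤ c i a₀ := by
      classical
      obtain ⟨a₀, ha₀, hmax⟩ := U'.toFinset.exists_max_image (c i)
        (by simpa [Multiset.toFinset_nonempty] using hne)
      exact ⟨a₀, by simpa using ha₀, fun b hb => hmax b (by simpa using hb)⟩
    have hmaxW : ∀ b ∈ W', c i b ≤ c i a₀ := by
      intro b hb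
      have : c i b ∈ U'.map (c i) := by rw [hmap]; exact mem_map_of_mem _ hb
      obtain ⟨b', hb', e⟩ := mem_map.1 this
      exact e ▸ hmax b' hb'
    have hcard : (U'.filter (fun a => c i a = c i a₀)).card =
        (W'.filter (fun a => c i a = c i a₀)).card := by
      have := congrArg (count (c i a₀)) (hmap i)
      simpa [count_map, eq_comm] using this
    have hconst' : ∀ j : Fin p, j.val < l + 1 → ∃ v,
        (∀ a ∈ U'.filter (fun a => c i a = c i a₀), c j a = v) ∧
        ∀ a ∈ W'.filter (fun a => c i a = c i a₀), c j a = v := by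
      intro j hj
      rcases Nat.lt_succ_iff_lt_or_eq.1 hj with hj | hj
      · obtain ⟨v, h1, h2⟩ := hconst j hj
        exact ⟨v, fun a ha => h1 a (mem_filter.1 ha).1, fun a ha => h2 a (mem_filter.1 ha).1⟩
      · obtain rfl : j = i := Fin.ext hj
        exact ⟨c i a₀, fun a ha => (mem_filter.1 ha).2, fun a ha => (mem_filter.1 ha).2⟩
    have split : ∀ (V : Multiset α) (j : Fin p), V.map (c j) =
        (V.filter (fun a => c i a = c i a₀)).map (c j) +
          (V.filter (fun a => ¬ c i a = c i a₀)).map (c j) := by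
      intro V j
      rw [← Multiset.map_add, filter_add_not]
    have lower : ∀ V : Multiset α, V.PairwiseAntidiagonal c → (∀ b ∈ V, c i b ≤ c i a₀) →
        (∀ j : Fin p, j.val < l → ∃ v, ∀ a ∈ V, c j a = v) → ∀ j > i,
        ∀ x ∈ (V.filter (fun a => c i a = c i a₀)).map (c j),
        ∀ y ∈ (V.filter (fun a => ¬ c i a = c i a₀)).map (c j), x ≤ y := by
      intro V hV hle hc j hj x hx y hy
      obtain ⟨a, ha, rfl⟩ := mem_map.1 hx
      obtain ⟨b, hb, rfl⟩ := mem_map.1 hy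
      rw [mem_filter] at ha hb
      refine hV a ha.1 b hb.1 i (fun q hq => ?_) ?_ j hj
      · obtain ⟨v, hv⟩ := hc q hq
        rw [hv a ha.1, hv b hb.1]
      · rw [ha.2]
        exact lt_of_le_of_ne (hle b hb.1) hb.2
    refine ⟨_, (filter_le (fun a => c i a = c i a₀) U').trans hUU, _,
      (filter_le (fun a => c i a = c i a₀) W').trans hWW, ?_, fun j => ?_, hconst'⟩
    · intro h0
      exact notMem_zero a₀ (h0 ▸ mem_filter.2 ⟨ha₀, rfl⟩)
    · by_cases hj : j.val < l + 1
      · obtain ⟨v, h1, h2⟩ := hconst' j hj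
        rw [map_congr rfl h1, map_congr rfl h2, map_const', map_const', hcard]
      · refine eq_of_add_eq_add_of_le (((split U' j).symm.trans (hmap j)).trans (split W' j))
          (by simpa using hcard) (lower U' (hU.mono hUU) hmax ?_ j ?_)
          (lower W' (hW.mono hWW) hmaxW ?_ j ?_)
        · exact fun q hq => (hconst q hq).imp fun v hv => hv.1
        · exact Fin.lt_def.2 (by simp only [i]; omega)
        · exact fun q hq => (hconst q hq).imp fun v hv => hv.2
        · exact Fin.lt_def.2 (by simp only [i]; omega)

/-- A pairwise antidiagonal multiset is determined by its marginals, provided that an element is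
determined by its coordinates. -/
theorem Multiset.PairwiseAntidiagonal.eq_of_map_eq {α : Type*} {p : ℕ} {c : Fin (p + 1) → α → ℕ}
    (hc : ∀ a b, (∀ j, c j a = c j b) → a = b) (U W : Multiset α)
    (hU : U.PairwiseAntidiagonal c) (hW : W.PairwiseAntidiagonal c)
    (h : ∀ j, U.map (c j) = W.map (c j)) : U = W := by
  induction hn : U.card generalizing U W with
  | zero =>
    have := congrArg card (h 0)
    rw [card_map, card_map, hn] at this
    rw [card_eq_zero.1 hn, card_eq_zero.1 this.symm]
  | succ d ih =>
    obtain ⟨U', hUU, W', hWW, hne, hmap, hconst⟩ :=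
      exists_le_map_eq_of_pairwiseAntidiagonal hU hW h (by rintro rfl; simp at hn) (p + 1) le_rfl
    obtain ⟨a, ha⟩ := exists_mem_of_ne_zero hne
    obtain ⟨b, hb⟩ : ∃ b, b ∈ W' := by
      refine exists_mem_of_ne_zero ?_
      rintro rfl
      exact hne (by simpa using hmap 0)
    obtain rfl : a = b := hc a b fun j => by
      obtain ⟨v, h1, h2⟩ := hconst j j.isLt
      rw [h1 a ha, h2 b hb]
    obtain ⟨U₁, rfl⟩ := exists_cons_of_mem (mem_of_le hUU ha)
    obtain ⟨W₁, rfl⟩ := exists_cons_of_mem (mem_of_le hWW hb)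
    rw [ih U₁ W₁ (hU.mono (le_cons_self _ _)) (hW.mono (le_cons_self _ _))
      (fun j => by simpa using h j) (by simpa using hn)]

/-! ### Ideals generated by binomials -/

/-- An ideal generated by differences of monomials that have the same value under an additive map
`Φ` is contained in the kernel of the induced map of monoid algebras.  So the support of a member
of the ideal never meets a fibre of `Φ` in a single monomial. -/
theorem MvPolynomial.exists_ne_mem_support_of_mem_span {σ k M : Type*} [Field k]
    [AddCommMonoid M] (Φ : (σ →₀ ℕ) →+ M) {A : Set (MvPolynomial σ k)}
    (hA : ∀ q ∈ A, ∃ u v, Φ u = Φ v ∧ q = monomial u 1 - monomial v 1)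
    {f : MvPolynomial σ k} (hf : f ∈ Ideal.span A) {u : σ →₀ ℕ} (hu : u ∈ f.support) :
    ∃ w ∈ f.support, w ≠ u ∧ Φ w = Φ u := by
  by_contra! hcon
  let ψ : MvPolynomial σ k →+* AddMonoidAlgebra k M := AddMonoidAlgebra.mapDomainRingHom k Φ
  have hψ : ∀ w c, ψ (monomial w c) = AddMonoidAlgebra.single (Φ w) c :=
    fun w c => AddMonoidAlgebra.mapDomain_single
  have hker : Ideal.span A ≤ RingHom.ker ψ := by
    refine Ideal.span_le.2 fun q hq => ?_
    obtain ⟨v, w, hvw, rfl⟩ := hA q hq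
    rw [SetLike.mem_coe, RingHom.mem_ker, map_sub, hψ, hψ, hvw, sub_self]
  have h0 : ψ f = 0 := hker hf
  have h1 : (ψ f).coeff (Φ u) = f.coeff u := by
    conv_lhs => rw [f.as_sum, map_sum]
    simp only [hψ, AddMonoidAlgebra.coeff_sum, AddMonoidAlgebra.coeff_single,
      Finsupp.finsetSum_apply]
    rw [Finset.sum_eq_single u]
    · simp
    · intro w hw hwu
      exact Finsupp.single_eq_of_ne' (hcon w hw hwu)
    · exact fun h => absurd hu h
  rw [h0] at h1
  exact mem_support_iff.1 hu (by simpa using h1.symm)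

namespace Hypermatrix

variable {n : ℕ} {r : Fin n → ℕ}

/-! ### Connected classes of switchable sets -/

theorem ConnectedIn.refl {S : Set (Index r)} {a : Index r} (ha : a ∈ S) : ConnectedIn S a a :=
  ⟨ha, ha, .refl⟩

theorem ConnectedIn.symm {S : Set (Index r)} {a b : Index r} (h : ConnectedIn S a b) :
    ConnectedIn S b a := by
  refine ⟨h.2.1, h.1, Relation.reflTransGen_swap.1 (Relation.ReflTransGen.mono ?_ _ _ h.2.2)⟩
  exact fun u v huv => ⟨huv.2.1, huv.1, hammingDist_comm u v ▸ huv.2.2⟩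

theorem ConnectedIn.trans {S : Set (Index r)} {a b c : Index r} (h : ConnectedIn S a b)
    (h' : ConnectedIn S b c) : ConnectedIn S a c :=
  ⟨h.1, h'.2.1, h.2.2.trans h'.2.2⟩

theorem switch_empty (a b : Index r) : switch ∅ a b = a := by
  ext; simp [switch]

theorem switch_singleton_eq_left {a b : Index r} {i : Fin n} (h : a i = b i) :
    switch {i} a b = a := by
  ext l
  by_cases hl : l = i
  · subst hl; simp [switch, h]
  · simp [switch, hl]

theorem hammingDist_switch_singleton {a b : Index r} {i : Fin n} (h : a i ≠ b i) :
    hammingDist a (switch {i} a b) = 1 := by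
  rw [hammingDist, Finset.card_eq_one]
  refine ⟨i, Finset.ext fun l => ?_⟩
  by_cases hl : l = i
  · subst hl; simpa [switch] using h
  · simp [switch, hl]

theorem switch_insert (i : Fin n) (K : Finset (Fin n)) (a b : Index r) :
    switch (insert i K) a b = switch {i} (switch K a b) b := by
  ext l
  by_cases hl : l = i
  · simp [switch, hl]
  · simp [switch, hl]

theorem switch_insert' {i : Fin n} {K : Finset (Fin n)} (hi : i ∉ K) (a b : Index r) :
    switch (insert i K) a b = switch {i} (switch K a b) (switch K b a) := by
  ext l
  by_cases hl : l = i
  · subst hl; simp [switch, hi]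
  · simp [switch, hl]

/-- Walk from `b` to `a` inside `S`: switchability propagates the `i`th entry of `b` along the
path. -/
theorem ConnectedIn.switch_singleton_mem {t : ℕ} {S : Set (Index r)} (hS : IsSwitchable t S)
    {i : Fin n} (hi : i ∈ firstComponents n t) {a b : Index r} (h : ConnectedIn S a b) :
    switch {i} a b ∈ S := by
  have hpath := h.symm.2.2
  induction hpath with
  | refl => rw [switch_singleton_eq_left rfl]; exact h.2.1
  | @tail c d hbc hcd ih =>
    obtain ⟨hc, hd, hdist⟩ := hcd
    have ihc : switch {i} c b ∈ S := ih (ConnectedIn.symm ⟨h.2.1, hc, hbc⟩)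
    obtain ⟨l, hl⟩ := Finset.card_eq_one.1 hdist
    have hdiff : ∀ q, c q ≠ d q ↔ q = l := fun q => by
      simpa using Finset.ext_iff.1 hl q
    by_cases hli : l = i
    · -- `c` and `d` differ in component `i` only, which is overwritten
      have : switch {i} d b = switch {i} c b := by
        ext q
        by_cases hq : q = i
        · simp [switch, hq]
        · have := (not_congr (hdiff q)).2 (hli ▸ hq)
          simp [switch, hq, not_not.1 this]
      rwa [this]
    · have hci : c i = d i := not_not.1 ((not_congr (hdiff i)).2 (Ne.symm hli))
      by_cases hdb : d i = b i
      · rwa [switch_singleton_eq_left hdb]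
      · have h2 : hammingDist d (switch {i} c b) = 2 := by
          rw [hammingDist, Finset.card_eq_two]
          refine ⟨l, i, hli, Finset.ext fun q => ?_⟩
          by_cases hq : q = i
          · subst hq; simpa [switch] using hdb
          · rw [Finset.mem_filter]
            simp [switch, hq, ← hdiff q, ne_comm]
        have h3 := hS d hd _ ihc h2 i hi
        have : switch {i} d (switch {i} c b) = switch {i} d b := by
          ext q
          by_cases hq : q = i <;> simp [switch, hq]
        rwa [this] at h3

theorem ConnectedIn.switch_singleton {t : ℕ} {S : Set (Index r)} (hS : IsSwitchable t S)
    {i : Fin n} (hi : i ∈ firstComponents n t) {a b : Index r} (h : ConnectedIn S a b) :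
    ConnectedIn S a (switch {i} a b) := by
  by_cases hab : a i = b i
  · rw [switch_singleton_eq_left hab]; exact .refl h.1
  · have hmem := h.switch_singleton_mem hS hi
    exact ⟨h.1, hmem, .single ⟨h.1, hmem, hammingDist_switch_singleton hab⟩⟩

/-- A connected class of a `t`-switchable set is closed under switching any components in `[t]`;
hence it is a product of subsets of the first `t` factors and of a set of tails. -/
theorem ConnectedIn.switch {t : ℕ} {S : Set (Index r)} (hS : IsSwitchable t S)
    {K : Finset (Fin n)} (hK : K ⊆ firstComponents n t) {a b : Index r} (h : ConnectedIn S a b) :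
    ConnectedIn S a (switch K a b) := by
  induction K using Finset.induction_on with
  | empty => rw [switch_empty]; exact .refl h.1
  | insert i K hi ih =>
    have h1 := ih fun x hx => hK (Finset.mem_insert_of_mem hx)
    rw [switch_insert]
    exact h1.trans ((h1.symm.trans h).switch_singleton hS (hK (Finset.mem_insert_self _ _)))

/-! ### The minors -/

theorem minor_eq_monomial_sub {k : Type*} [Field k] (K : Finset (Fin n)) (a b : Index r) :
    minor k K a b = MvPolynomial.monomial (pairExponent a b) 1 -
      MvPolynomial.monomial (pairExponent (switch K a b) (switch K b a)) 1 := by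
  simp [minor, pairExponent, MvPolynomial.X, MvPolynomial.monomial_mul]

/-- Switching the members of `K` one at a time writes `f_{K,a,b}` as a telescoping sum of
generators. -/
theorem minor_mem_switchIdeal {k : Type*} [Field k] {t : ℕ} {S : Set (Index r)}
    (hS : IsSwitchable t S) {K : Finset (Fin n)} (hK : K ⊆ firstComponents n t) {a b : Index r}
    (h : ConnectedIn S a b) : minor k K a b ∈ switchIdeal k t S := by
  induction K using Finset.induction_on with
  | empty => simp [minor, switch_empty]
  | insert i K hi ih =>
    have hK' : K ⊆ firstComponents n t := fun x hx => hK (Finset.mem_insert_of_mem hx)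
    have e : minor k (insert i K) a b =
        minor k K a b + minor k {i} (switch K a b) (switch K b a) := by
      simp only [minor, switch_insert' hi]
      ring
    rw [e]
    refine add_mem (ih hK') (Ideal.subset_span ⟨i, hK (Finset.mem_insert_self _ _), _, _, ?_, rfl⟩)
    exact (h.switch hS hK').symm.trans (h.trans (h.symm.switch hS hK'))

theorem finite_switchBasis (k : Type*) [Field k] (t : ℕ) (S : Set (Index r)) :
    (switchBasis k t S).Finite := by
  refine (Set.finite_range fun x : Finset (Fin n) × Index r × Index r =>
    minor k x.1 x.2.1 x.2.2).subset ?_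
  rintro _ ⟨K, -, a, b, -, rfl⟩
  exact ⟨(K, a, b), rfl⟩

theorem switchSet_subset {t : ℕ} (c : Fin (t + 1)) : switchSet n c ⊆ firstComponents n t := by
  unfold switchSet
  split_ifs with h
  · intro i hi
    rw [Finset.mem_filter] at hi
    simp [firstComponents, hi.2, h]
  · exact subset_rfl

/-- If `x_{a'} x_{b'}` is smaller than `x_a x_b`, then `x_a x_b` is the leading term of
`f_{K,a,b}`. -/
theorem leadingTerm_minor {k : Type*} [Field k] (m : MonomialOrder (Index r))
    {K : Finset (Fin n)} {a b : Index r}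
    (h : m.toSyn (pairExponent (switch K a b) (switch K b a)) < m.toSyn (pairExponent a b)) :
    m.leadingTerm (minor k K a b) = MvPolynomial.monomial (pairExponent a b) 1 := by
  classical
  have hd : m.toSyn (m.degree (-MvPolynomial.monomial
      (pairExponent (switch K a b) (switch K b a)) (1 : k))) <
      m.toSyn (m.degree (MvPolynomial.monomial (pairExponent a b) (1 : k))) := by
    rw [m.degree_neg, m.degree_monomial, m.degree_monomial]
    simpa using h
  rw [minor_eq_monomial_sub, sub_eq_add_neg, MonomialOrder.leadingTerm,
    m.degree_add_of_lt hd, m.leadingCoeff_add_of_lt hd, m.leadingCoeff_monomial,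
    m.degree_monomial, if_neg one_ne_zero]

/-! ### The marginals of a monomial -/

/-- The relation of being equal or connected in `S`: its classes are the connected classes of `S`
and the singletons outside `S`. -/
def connectedSetoid (S : Set (Index r)) : Setoid (Index r) where
  r a b := a = b ∨ ConnectedIn S a b
  iseqv :=
    { refl := fun _ => .inl rfl
      symm := fun h => h.imp Eq.symm ConnectedIn.symm
      trans := by
        rintro a b c (rfl | h) (rfl | h')
        · exact .inl rfl
        · exact .inr h'
        · exact .inr h
        · exact .inr (h.trans h') }

open Classical in
/-- The multiset of the indices of class `q` occurring in the monomial with exponent vector `u`. -/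
noncomputable def classPart (S : Set (Index r)) (u : Index r →₀ ℕ)
    (q : Quotient (connectedSetoid S)) : Multiset (Index r) :=
  (Finsupp.toMultiset u).filter fun b => Quotient.mk (connectedSetoid S) b = q

theorem classPart_add (S : Set (Index r)) (u v : Index r →₀ ℕ)
    (q : Quotient (connectedSetoid S)) :
    classPart S (u + v) q = classPart S u q + classPart S v q := by
  simp [classPart]

theorem eq_of_classPart_eq {S : Set (Index r)} {u v : Index r →₀ ℕ}
    (h : ∀ q, classPart S u q = classPart S v q) : u = v := by
  classical
  ext a
  have := congrArg (Multiset.count a) (h (Quotient.mk _ a))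
  simpa [classPart, Multiset.count_filter, Finsupp.count_toMultiset] using this

/-- The marginals of a monomial: for every connected class and each of the `t + 1` components, the
multiset of the values of that component at the indices of that class which occur in the
monomial. -/
noncomputable def marginals {t : ℕ} (ht : t ≤ n)
    (e : Tail r t ≃ Fin (Fintype.card (Tail r t))) (S : Set (Index r)) :
    (Index r →₀ ℕ) →+ (Quotient (connectedSetoid S) → Fin (t + 1) → Multiset ℕ) where
  toFun u q c := (classPart S u q).map fun a => component ht e a c
  map_zero' := by ext; simp [classPart]
  map_add' u v := by
    funext q c
    rw [classPart_add, Multiset.map_add]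
    rfl

theorem component_ext {t : ℕ} (ht : t ≤ n) (e : Tail r t ≃ Fin (Fintype.card (Tail r t)))
    {a b : Index r} (h : ∀ c, component ht e a c = component ht e b c) : a = b := by
  funext i
  by_cases hi : i.val < t
  · have := h ⟨i.val, by omega⟩
    simpa [component, hi, Fin.val_inj] using this
  · have := h (Fin.last t)
    simp only [component, Fin.val_last, lt_irrefl, dite_false, Fin.val_inj,
      EmbeddingLike.apply_eq_iff_eq] at this
    exact congrFun this ⟨i, by omega⟩

theorem component_switch {t : ℕ} (ht : t ≤ n) (e : Tail r t ≃ Fin (Fintype.card (Tail r t)))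
    {K : Finset (Fin n)} (hK : K ⊆ firstComponents n t) (a b : Index r) (c : Fin (t + 1)) :
    (component ht e (switch K a b) c = component ht e a c ∧
      component ht e (switch K b a) c = component ht e b c) ∨
    (component ht e (switch K a b) c = component ht e b c ∧
      component ht e (switch K b a) c = component ht e a c) := by
  by_cases hc : c.val < t
  · by_cases hcK : (⟨c.val, hc.trans_le ht⟩ : Fin n) ∈ K
    · right; simp [component, hc, switch, hcK]
    · left; simp [component, hc, switch, hcK]
  · left
    have key : ∀ x y : Index r, (fun i : {i : Fin n // t ≤ i.val} => switch K x y i.val) =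
        fun i : {i : Fin n // t ≤ i.val} => x i.val := by
      intro x y
      funext i
      have : (i : Fin n) ∉ K := fun h => by
        have := (Finset.mem_filter.1 (hK h)).2
        have := i.2
        omega
      simp [switch, this]
    simp only [component, hc, dite_false, key, and_self]

theorem marginals_switch {t : ℕ} (ht : t ≤ n) (e : Tail r t ≃ Fin (Fintype.card (Tail r t)))
    {S : Set (Index r)} (hS : IsSwitchable t S) {K : Finset (Fin n)}
    (hK : K ⊆ firstComponents n t) {a b : Index r} (h : ConnectedIn S a b) :
    marginals ht e S (pairExponent (switch K a b) (switch K b a)) =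
      marginals ht e S (pairExponent a b) := by
  have hmk : ∀ {x y : Index r}, ConnectedIn S x y →
      Quotient.mk (connectedSetoid S) x = Quotient.mk (connectedSetoid S) y :=
    fun hxy => Quotient.sound (.inr hxy)
  have h1 := (hmk (h.switch hS hK)).symm
  have h2 := (hmk (h.symm.switch hS hK)).symm.trans (hmk h).symm
  have h3 := (hmk h).symm
  have single : ∀ (x : Index r) q c, marginals ht e S (Finsupp.single x 1) q c =
      open Classical in if Quotient.mk (connectedSetoid S) x = q then {component ht e x c}
        else 0 := by
    intro x q c
    simp only [marginals, classPart, AddMonoidHom.coe_mk, ZeroHom.coe_mk,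
      Finsupp.toMultiset_single, one_smul, Multiset.filter_singleton]
    split_ifs <;> simp
  funext q c
  simp only [pairExponent, map_add, Pi.add_apply, single]
  by_cases hq : Quotient.mk (connectedSetoid S) a = q
  · rw [if_pos (h1.trans hq), if_pos (h2.trans hq), if_pos hq, if_pos (h3.trans hq)]
    rcases component_switch ht e hK a b c with ⟨e1, e2⟩ | ⟨e1, e2⟩
    · rw [e1, e2]
    · rw [e1, e2, add_comm]
  · rw [if_neg (h1 ▸ hq), if_neg (h2 ▸ hq), if_neg hq, if_neg (h3 ▸ hq)]

/-! ### Standard monomials -/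

/-- The monomial with exponent vector `u` is standard if it is not divisible by any `x_a x_b`, with
`a, b` connected in `S`, which becomes smaller by switching some components in `[t]`; that is, if
no leading monomial of a nonzero `f_{K,a,b}` divides it. -/
def IsStandard (m : MonomialOrder (Index r)) (t : ℕ) (S : Set (Index r))
    (u : Index r →₀ ℕ) : Prop :=
  ∀ K ⊆ firstComponents n t, ∀ a b, ConnectedIn S a b → pairExponent a b ≤ u →
    m.toSyn (pairExponent a b) ≤ m.toSyn (pairExponent (switch K a b) (switch K b a))

theorem pairExponent_le {a b : Index r} {u : Index r →₀ ℕ} (hab : a ≠ b)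
    (ha : a ∈ Finsupp.toMultiset u) (hb : b ∈ Finsupp.toMultiset u) : pairExponent a b ≤ u := by
  rw [Finsupp.mem_toMultiset, Finsupp.mem_support_iff] at ha hb
  intro x
  simp only [pairExponent, Finsupp.add_apply, Finsupp.single_apply]
  split_ifs with h1 h2 h2
  · exact absurd (h1.trans h2.symm) hab
  · subst h1; omega
  · subst h2; omega
  · omega

/-- Under a `t`-diagonal order, a pair violating antidiagonality becomes smaller by switching the
component in which the violation occurs. -/
theorem IsStandard.pairwiseAntidiagonal {t : ℕ} {ht : t ≤ n}
    {e : Tail r t ≃ Fin (Fintype.card (Tail r t))} {δ : Equiv.Perm (Fin (t + 1))}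
    {m : MonomialOrder (Index r)} (hm : IsDiagonalOrder ht e δ m) {S : Set (Index r)}
    {u : Index r →₀ ℕ} (hu : IsStandard m t S u) (q : Quotient (connectedSetoid S)) :
    (classPart S u q).PairwiseAntidiagonal fun i a => component ht e a (δ i) := by
  classical
  intro a ha b hb i heq hlt j hj
  by_contra! hcon
  rw [classPart, Multiset.mem_filter] at ha hb
  have hne : a ≠ b := by rintro rfl; exact lt_irrefl _ hlt
  have hconn : ConnectedIn S a b := (Quotient.exact (ha.2.trans hb.2.symm)).resolve_left hne
  exact (hu _ (switchSet_subset (δ j)) a b hconn (pairExponent_le hne ha.1 hb.1)).not_gt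
    ((hm a b i j heq hlt.ne' hj hcon).2 hlt)

/-- A standard monomial is determined by its marginals. -/
theorem IsStandard.eq_of_marginals_eq {t : ℕ} {ht : t ≤ n}
    {e : Tail r t ≃ Fin (Fintype.card (Tail r t))} {δ : Equiv.Perm (Fin (t + 1))}
    {m : MonomialOrder (Index r)} (hm : IsDiagonalOrder ht e δ m) {S : Set (Index r)}
    {u w : Index r →₀ ℕ} (hu : IsStandard m t S u) (hw : IsStandard m t S w)
    (h : marginals ht e S u = marginals ht e S w) : u = w := by
  refine eq_of_classPart_eq (S := S) fun q => ?_
  refine Multiset.PairwiseAntidiagonal.eq_of_map_eq (fun a b hab => ?_) _ _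
    (hu.pairwiseAntidiagonal hm q) (hw.pairwiseAntidiagonal hm q)
    fun j => congrFun (congrFun h q) (δ j)
  exact component_ext ht e fun c => by simpa using hab (δ.symm c)

/-- The smallest monomial with given marginals is standard. -/
theorem exists_isStandard_marginals_eq {t : ℕ} (ht : t ≤ n)
    (e : Tail r t ≃ Fin (Fintype.card (Tail r t))) (m : MonomialOrder (Index r))
    {S : Set (Index r)} (hS : IsSwitchable t S) (u : Index r →₀ ℕ) :
    ∃ w, marginals ht e S w = marginals ht e S u ∧ IsStandard m t S w ∧
      ∀ v, marginals ht e S v = marginals ht e S u → m.toSyn w ≤ m.toSyn v := by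
  obtain ⟨w, hw, hmin⟩ := (InvImage.wf m.toSyn wellFounded_lt).has_min
    {w | marginals ht e S w = marginals ht e S u} ⟨u, rfl⟩
  refine ⟨w, hw, fun K hK a b hab hle => ?_, fun v hv => not_lt.1 (hmin v hv)⟩
  obtain ⟨v, rfl⟩ := exists_add_of_le hle
  have h := hmin (pairExponent (switch K a b) (switch K b a) + v) (by
    rw [Set.mem_ofPred_eq, map_add, marginals_switch ht e hS hK hab, ← map_add]
    exact hw)
  simpa [InvImage] using h

/-- The leading monomial of a nonzero member of the ideal is not standard: it shares its marginals
with another, hence smaller, monomial of the polynomial, but a standard monomial is the smallest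
one with its marginals. -/
theorem not_isStandard_degree {k : Type*} [Field k] {t : ℕ} {ht : t ≤ n}
    {e : Tail r t ≃ Fin (Fintype.card (Tail r t))} {δ : Equiv.Perm (Fin (t + 1))}
    {m : MonomialOrder (Index r)} (hm : IsDiagonalOrder ht e δ m) {S : Set (Index r)}
    (hS : IsSwitchable t S) {f : MvPolynomial (Index r) k} (hf : f ∈ switchIdeal k t S)
    (hf0 : f ≠ 0) : ¬ IsStandard m t S (m.degree f) := by
  intro hstd
  obtain ⟨v, hv, hne, hmv⟩ := MvPolynomial.exists_ne_mem_support_of_mem_span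
    (marginals ht e S) (A := {p | ∃ i ∈ firstComponents n t, ∃ a b : Index r,
      ConnectedIn S a b ∧ p = minor k {i} a b}) (by
        rintro _ ⟨i, hi, a, b, hab, rfl⟩
        exact ⟨_, _, (marginals_switch ht e hS (Finset.singleton_subset_iff.2 hi) hab).symm,
          minor_eq_monomial_sub _ _ _⟩) hf (m.degree_mem_support hf0)
  obtain ⟨w, hw, hwstd, hmin⟩ := exists_isStandard_marginals_eq ht e m hS (m.degree f)
  obtain rfl := hwstd.eq_of_marginals_eq hm hstd hw
  exact hne (m.toSyn.injective (le_antisymm (m.le_degree hv) (hmin v hmv)))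

theorem isGroebnerBasis_switchBasis (k : Type*) [Field k] {t : ℕ} {ht : t ≤ n}
    {e : Tail r t ≃ Fin (Fintype.card (Tail r t))} {δ : Equiv.Perm (Fin (t + 1))}
    {m : MonomialOrder (Index r)} (hm : IsDiagonalOrder ht e δ m) {S : Set (Index r)}
    (hS : IsSwitchable t S) : IsGroebnerBasis m (switchBasis k t S) (switchIdeal k t S) := by
  have hsub : switchBasis k t S ⊆ (switchIdeal k t S : Set (MvPolynomial (Index r) k)) := by
    rintro _ ⟨K, hK, a, b, hab, rfl⟩
    exact minor_mem_switchIdeal hS hK hab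
  refine ⟨finite_switchBasis k t S, hsub,
    le_antisymm (Ideal.span_mono (Set.image_mono hsub)) (Ideal.span_le.2 ?_)⟩
  rintro _ ⟨f, hf, rfl⟩
  rcases eq_or_ne f 0 with rfl | hf0
  · simp
  have hstd := not_isStandard_degree hm hS hf hf0
  unfold IsStandard at hstd
  push Not at hstd
  obtain ⟨K, hK, a, b, hab, hle, hlt⟩ := hstd
  obtain ⟨v, hv⟩ := exists_add_of_le hle
  have e1 : m.leadingTerm f = MvPolynomial.monomial v (m.leadingCoeff f) *
      m.leadingTerm (minor k K a b) := by
    rw [leadingTerm_minor m hlt, MvPolynomial.monomial_mul, mul_one, MonomialOrder.leadingTerm,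
      hv, add_comm]
  rw [e1]
  exact Ideal.mul_mem_left _ _ (Ideal.subset_span ⟨_, ⟨K, hK, a, b, hab, rfl⟩, rfl⟩)

theorem IsGroebnerBasis.sdiff_singleton_zero {σ k : Type*} [Field k] {m : MonomialOrder σ}
    {G : Set (MvPolynomial σ k)} {I : Ideal (MvPolynomial σ k)} (h : IsGroebnerBasis m G I) :
    IsGroebnerBasis m (G \ {0}) I := by
  refine ⟨h.1.subset Set.sdiff_subset, Set.sdiff_subset.trans h.2.1, ?_⟩
  rw [← h.2.2, m.image_leadingTerm_sdiff_singleton_zero, Ideal.span_sdiff_singleton_zero]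

end Hypermatrix

theorem mainTheorem5 {k : Type*} [Field k] {n : ℕ} (r : Fin n → ℕ) (hr : ∀ i, 0 < r i)
    {t : ℕ} (ht₁ : 1 ≤ t) (ht : t ≤ n) (S : Set (Hypermatrix.Index r))
    (hS : Hypermatrix.IsSwitchable t S)
    (e : Hypermatrix.Tail r t ≃ Fin (Fintype.card (Hypermatrix.Tail r t)))
    (δ : Equiv.Perm (Fin (t + 1)))
    (m : MonomialOrder (Hypermatrix.Index r)) (hm : Hypermatrix.IsDiagonalOrder ht e δ m) :
    Hypermatrix.IsGroebnerBasis m (Hypermatrix.switchBasis k t S)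
        (Hypermatrix.switchIdeal k t S) ∧
      (S.Nonempty → ∃ G' ⊂ Hypermatrix.switchBasis k t S,
        Hypermatrix.IsGroebnerBasis m G' (Hypermatrix.switchIdeal k t S)) := by
  have hG := Hypermatrix.isGroebnerBasis_switchBasis k hm hS
  refine ⟨hG, fun ⟨a, ha⟩ => ⟨_, Set.sdiff_singleton_ssubset.2 ?_, hG.sdiff_singleton_zero⟩⟩
  -- `f_{∅,a,a} = 0` belongs to the basis, and if `S = {a}` it is the only member
  exact ⟨∅, Finset.empty_subset _, a, a, .refl ha, by
    simp [Hypermatrix.minor, Hypermatrix.switch_empty]⟩
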